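/- **Conventions.** All structures are for finite relational languages and have universe a subset of $\omega$. The atomic diagram $D(\mathcal A)$ is the set of atomic sentences and negations of atomic sentences, with constants (naming themselves) from the universe of $\mathcal A$, that are true in $\mathcal A$. Let $K,K'$ be classes of structures, each class for a single language. A *computable transformation* from $K$ to $K'$ is a c.e. set $\Phi$ of pairs $(\alpha,\varphi)$, where $\alpha$ is a finite subset of the atomic diagram of a finite structure for the language of $K$ and $\varphi$ is an atomic sentence or the negation of one in the language of $K'$, such that for every $\mathcal A\in K$ the set $$\Phi(D(\mathcal A))=\{\varphi : (\exists \alpha\subseteq D(\mathcal A))\ (\alpha,\varphi)\in\Phi\}$$ equals $D(\mathcal B)$ for some $\mathcal B\in K'$; one writes $\Phi(\mathcal A)=\mathcal B$. It is a *computable embedding* of $K$ in $K'$ if moreover, for all $\mathcal A,\mathcal A'\in K$, $\mathcal A\cong\mathcal A'$ if and only if $\Phi(\mathcal A)\cong\Phi(\mathcal A')$. Let $LO$ be the class of all (possibly infinite) linear orders, in the language $\{\le\}$. Let $FVS$ be the class of finite-dimensional $\mathbb Q$-vector spaces, as structures whose universe is the disjoint union of the set of scalars (a copy of $\mathbb Q$)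 and the set of vectors, with unary relations for these two sorts and with relations for the graphs of $0,1,+,\cdot$ on the scalars, of the zero vector and vector addition, and of scalar multiplication. **Proposition 4.12.** $FVS\le_c LO$. Indeed, there is a computable embedding $\Phi$ of $FVS$ in $LO$ such that, for every $\mathcal V\in FVS$ of dimension $d$, the order $\Phi(\mathcal V)$ is isomorphic to a suborder of $\omega\cdot\eta$ (the lexicographic order on $\mathbb Q\times\omega$) of the form $$\{(q,k)\in\mathbb Q\times\omega : k<c(q)\},$$ where $c:\mathbb Q\to\{0,1,\dots,d\}\cup\{\infty\}$ and, for each $n\in\{1,\dots,d\}\cup\{\infty\}$, the set $\{q : c(q)=n\}$ is dense in $\mathbb Q$. That is, $\Phi(\mathcal V)$ is a shuffle of densely many copies of each finite order of size $1,\dots,d$ and densely many copies of $\omega$. -/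

import Mathlib

namespace CompEmb

open FirstOrder FirstOrder.Language

/-- A finite relational language together with a numbering of its relation symbols (used only to
assign Gödel numbers). -/
class FinRelLang (L : FirstOrder.Language.{0, 0}) where
  relational : L.IsRelational
  finite : Finite (Σ n, L.Relations n)
  symbolCode : (Σ n, L.Relations n) → ℕ
  symbolCode_injective : Function.Injective symbolCode

/-- A structure for the language `L` whose universe is a subset of `ω`. -/
structure NatStructure (L : FirstOrder.Language.{0, 0}) where
  carrier : Set ℕ
  str : L.Structure carrier

instance (L : FirstOrder.Language.{0, 0}) (A : NatStructure L) : L.Structure A.carrier := A.str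

/-- `A ≅ B`. -/
def Isomorphic {L : FirstOrder.Language.{0, 0}} (A B : NatStructure L) : Prop :=
  Nonempty (A.carrier ≃[L] B.carrier)

/-- Atomic sentences in a relational language `L` with the natural numbers added as constants. -/
inductive AtomicSentence (L : FirstOrder.Language.{0, 0}) : Type
  | eq (m n : ℕ) : AtomicSentence L
  | rel {n : ℕ} (R : L.Relations n) (v : Fin n → ℕ) : AtomicSentence L

namespace AtomicSentence

variable {L : FirstOrder.Language.{0, 0}}

/-- All constants occurring in the sentence name elements of the universe of `A`. -/
def IsOver (A : NatStructure L) : AtomicSentence L → Prop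
  | eq m n => m ∈ A.carrier ∧ n ∈ A.carrier
  | rel _ v => ∀ i, v i ∈ A.carrier

/-- Truth in `A`, each natural number in the universe of `A` naming itself. -/
def Holds (A : NatStructure L) : AtomicSentence L → Prop
  | eq m n => m = n
  | rel R v => ∃ h : ∀ i, v i ∈ A.carrier, Structure.RelMap R (fun i => (⟨v i, h i⟩ : A.carrier))

/-- The Gödel code: `0` stands for the equality symbol, and a relation symbol is represented by
its number plus one. -/
def code [FinRelLang L] : AtomicSentence L → ℕ × List ℕ
  | eq m n => (0, [m, n])
  | @rel _ n R v => (FinRelLang.symbolCode ⟨n, R⟩ + 1, List.ofFn v)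

end AtomicSentence

/-- Atomic sentences `(true, φ)` and negated atomic sentences `(false, φ)`. -/
abbrev Literal (L : FirstOrder.Language.{0, 0}) : Type := Bool × AtomicSentence L

/-- The type of Gödel codes of literals. -/
abbrev LitCode : Type := Bool × ℕ × List ℕ

def Literal.code {L : FirstOrder.Language.{0, 0}} [FinRelLang L] (φ : Literal L) : LitCode :=
  (φ.1, φ.2.code)

/-- The atomic diagram `D(A)`: the atomic sentences and negations of atomic sentences, with
constants from the universe of `A`, that are true in `A`. -/
def diagram {L : FirstOrder.Language.{0, 0}} (A : NatStructure L) : Set (Literal L) :=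
  {φ | φ.2.IsOver A ∧ (φ.1 = true ↔ φ.2.Holds A)}

variable {L L' : FirstOrder.Language.{0, 0}}

/-- `Φ(X) = {φ | ∃ α ⊆ X, (α, φ) ∈ Φ}`. -/
def enumApply (Φ : Set (Finset (Literal L) × Literal L')) (X : Set (Literal L)) :
    Set (Literal L') :=
  {φ | ∃ α : Finset (Literal L), (∀ ψ ∈ α, ψ ∈ X) ∧ (α, φ) ∈ Φ}

/-- `Φ` is c.e.: the set of its codes is recursively enumerable, where a finite set is coded by
any list enumerating the codes of its elements. -/
def IsCE [FinRelLang L] [FinRelLang L'] (Φ : Set (Finset (Literal L) × Literal L')) : Prop :=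
  REPred fun p : List LitCode × LitCode =>
    ∃ α φ, (α, φ) ∈ Φ ∧ (∀ c, c ∈ p.1 ↔ ∃ ψ ∈ α, Literal.code ψ = c) ∧ Literal.code φ = p.2

/-- `Φ` is a computable transformation from the class `K` to the class `K'`. -/
def IsComputableTransformation [FinRelLang L] [FinRelLang L']
    (Φ : Set (Finset (Literal L) × Literal L'))
    (K : Set (NatStructure L)) (K' : Set (NatStructure L')) : Prop :=
  IsCE Φ ∧
  (∀ p ∈ Φ, ∃ A : NatStructure L, A.carrier.Finite ∧ ∀ ψ ∈ p.1, ψ ∈ diagram A) ∧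
  ∀ A ∈ K, ∃ B ∈ K', enumApply Φ (diagram A) = diagram B

/-- `Φ` is a computable embedding of `K` in `K'`: a computable transformation that is well defined
and injective on isomorphism types. -/
def IsComputableEmbedding [FinRelLang L] [FinRelLang L']
    (Φ : Set (Finset (Literal L) × Literal L'))
    (K : Set (NatStructure L)) (K' : Set (NatStructure L')) : Prop :=
  IsComputableTransformation Φ K K' ∧
  ∀ A ∈ K, ∀ A' ∈ K, ∀ B B' : NatStructure L',
    enumApply Φ (diagram A) = diagram B → enumApply Φ (diagram A') = diagram B' →
      (Isomorphic A A' ↔ Isomorphic B B')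

/-- The class of all linear orders (with universe a subset of `ω`), in the language of `≤`. -/
def LO : Set (NatStructure FirstOrder.Language.order) :=
  {B | B.carrier ⊨ FirstOrder.Language.order.linearOrderTheory}

instance : FinRelLang FirstOrder.Language.order where
  relational := inferInstance
  finite := inferInstance
  symbolCode _ := 0
  symbolCode_injective := fun _ _ _ => Subsingleton.elim _ _

/-- The relation symbols of the language of vector spaces with a sort of scalars; constants and
operations are represented by their graphs. -/
inductive VSRel : ℕ → Type
  | isVector : VSRel 1
  | isScalar : VSRel 1
  | zeroF : VSRel 1
  | oneF : VSRel 1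
  | addF : VSRel 3
  | mulF : VSRel 3
  | zeroV : VSRel 1
  | addV : VSRel 3
  | smulV : VSRel 3

/-- The language of vector spaces. -/
def vsLang : FirstOrder.Language.{0, 0} := ⟨fun _ => Empty, VSRel⟩

def vsSymbolCode : (Σ n, VSRel n) → ℕ
  | ⟨_, .isVector⟩ => 0
  | ⟨_, .isScalar⟩ => 1
  | ⟨_, .zeroF⟩ => 2
  | ⟨_, .oneF⟩ => 3
  | ⟨_, .addF⟩ => 4
  | ⟨_, .mulF⟩ => 5
  | ⟨_, .zeroV⟩ => 6
  | ⟨_, .addV⟩ => 7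
  | ⟨_, .smulV⟩ => 8

theorem vsSymbolCode_injective : Function.Injective vsSymbolCode := by
  rintro ⟨_, R⟩ ⟨_, S⟩ h
  cases R <;> cases S <;> first | rfl | (exact absurd h (by decide))

theorem vsSymbolCode_lt (x : Σ n, VSRel n) : vsSymbolCode x < 9 := by
  obtain ⟨_, R⟩ := x
  cases R <;> decide

instance : FinRelLang vsLang where
  relational := fun _ => inferInstanceAs (IsEmpty Empty)
  finite := Finite.of_injective (fun x => (⟨vsSymbolCode x, vsSymbolCode_lt x⟩ : Fin 9))
    fun _ _ h => vsSymbolCode_injective (congrArg Fin.val h)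
  symbolCode := vsSymbolCode
  symbolCode_injective := vsSymbolCode_injective

/-- The structure of a rational vector space `W`; its universe is the disjoint union of the scalar
field `ℚ` and the set of vectors `W`. -/
instance vsStructure (W : Type) [AddCommGroup W] [Module ℚ W] : vsLang.Structure (ℚ ⊕ W) where
  funMap := fun f => Empty.elim f
  RelMap := fun {_} R => match R with
    | .isVector => fun v => ∃ w : W, v 0 = .inr w
    | .isScalar => fun v => ∃ q : ℚ, v 0 = .inl q
    | .zeroF => fun v => v 0 = .inl 0
    | .oneF => fun v => v 0 = .inl 1
    | .addF => fun v => ∃ p q : ℚ, v 0 = .inl p ∧ v 1 = .inl q ∧ v 2 = .inl (p + q)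
    | .mulF => fun v => ∃ p q : ℚ, v 0 = .inl p ∧ v 1 = .inl q ∧ v 2 = .inl (p * q)
    | .zeroV => fun v => v 0 = .inr 0
    | .addV => fun v => ∃ x y : W, v 0 = .inr x ∧ v 1 = .inr y ∧ v 2 = .inr (x + y)
    | .smulV => fun v => ∃ (q : ℚ) (x : W), v 0 = .inl q ∧ v 1 = .inr x ∧ v 2 = .inr (q • x)

/-- `A` is (a copy of) a rational vector space of finite dimension `d`. -/
def IsVectorSpaceOfDim (d : ℕ) (A : NatStructure vsLang) : Prop :=
  ∃ (W : Type) (_ : AddCommGroup W) (_ : Module ℚ W),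
    FiniteDimensional ℚ W ∧ Module.finrank ℚ W = d ∧ Nonempty (A.carrier ≃[vsLang] (ℚ ⊕ W))

/-- The class of finite-dimensional rational vector spaces. -/
def FVS : Set (NatStructure vsLang) :=
  {A | ∃ d, IsVectorSpaceOfDim d A}

/-- `B` is isomorphic to a suborder of `ω·η` (that is, of `ℚ × ℕ` ordered lexicographically) in
which the copy of `ω` at each `q` is cut down to its first `c q` elements, where every value
`c q` is either at most `d` or infinite, and the values `1, …, d` and `∞` are all taken densely.
Points `q` with `c q = 0` contribute nothing. -/
def IsShuffle (d : ℕ) (B : NatStructure FirstOrder.Language.order) : Prop :=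
  ∃ c : ℚ → ℕ∞,
    (∀ q, c q ≤ d ∨ c q = ⊤) ∧
    (∀ n : ℕ, 1 ≤ n → n ≤ d → Dense {q | c q = n}) ∧
    Dense {q | c q = ⊤} ∧
    ∃ e : B.carrier ≃ {x : ℚ ×ₗ ℕ // ((ofLex x).2 : ℕ∞) < c (ofLex x).1},
      ∀ x y : B.carrier,
        Structure.RelMap (leSymb : FirstOrder.Language.order.Relations 2) ![x, y] ↔ (e x).1 ≤ (e y).1

end CompEmb

/-! Attach to each tuple `t` of natural numbers densely many blocks in `ω·η`, at places that do not
depend on the input. The block of `t` is empty unless the entries of `t` are vectors; then it has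
`t.length` points if the entries are linearly independent, and is a copy of `ω` otherwise. Both
clauses are positive: once the entries are seen to be vectors the first `t.length` points may be
enumerated, and once a dependence is seen all the others may be. The order between coded points is
decidable outright, so only membership has to be read off from the diagram, and finitely many
positive facts (a `Certificate`) witness it.

In dimension `d` the independent tuples have lengths `0, …, d`, each of these occurring, and the
tuple consisting of the zero vector is dependent. Hence the finite nonempty block sizes are `1, …,
d`, and these sizes and `∞` are all dense (`isShuffleMap_sizeAt`).

Such a shuffle determines `d` and is determined by it. Two shuffles with the same `d` are isomorphic
by a back-and-forth argument that preserves block sizes (`exists_orderIso_of_realizesColors`).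
Conversely, being finitely far apart is an order invariant whose classes are the blocks, so the
finite block sizes recover `d` (`le_of_orderIso`). As dimension classifies the vector spaces,
isomorphism is preserved both ways. -/

section ColoredOrder

/-! ### Back-and-forth for coloured linear orders -/

variable {α β κ : Type} [LinearOrder α] [LinearOrder β]

/-- Every point of `β` can be matched in colour by a point of `α` in any prescribed finite cut. -/
def RealizesColors (f : α → κ) (g : β → κ) : Prop :=
  ∀ (b : β) (lo hi : Finset α), (∀ x ∈ lo, ∀ y ∈ hi, x < y) →
    ∃ a, f a = g b ∧ (∀ x ∈ lo, x < a) ∧ ∀ y ∈ hi, a < y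

/-- Finite partial isomorphisms that preserve colours. -/
def ColoredPartialIso (f : α → κ) (g : β → κ) : Type :=
  {s : Finset (α × β) // (∀ p ∈ s, ∀ q ∈ s, cmp p.1 q.1 = cmp p.2 q.2) ∧ ∀ p ∈ s, f p.1 = g p.2}

namespace ColoredPartialIso

instance (f : α → κ) (g : β → κ) : Preorder (ColoredPartialIso f g) :=
  inferInstanceAs (Preorder (Subtype _))

variable {f : α → κ} {g : β → κ}

instance : Inhabited (ColoredPartialIso f g) := ⟨⟨∅, by simp⟩⟩

/-- The "forth" step; colours of `g` are sought for a point of `α`, hence the direction of the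
hypothesis. -/
theorem exists_insert_left (h : RealizesColors g f) (s : ColoredPartialIso f g) (a : α) :
    ∃ t : ColoredPartialIso f g, (∃ b, (a, b) ∈ t.val) ∧ s ≤ t := by
  classical
  by_cases hm : ∃ b, (a, b) ∈ s.val
  · exact ⟨s, hm, le_rfl⟩
  -- The partner of `a` must lie in the cut formed by the partners of the points on either side of
  -- `a`.
  obtain ⟨b, hb, hlo, hhi⟩ := h a ({p ∈ s.val | p.1 < a}.image Prod.snd)
    ({p ∈ s.val | a < p.1}.image Prod.snd) (by
      intro x hx y hy
      simp only [Finset.mem_image, Finset.mem_filter] at hx hy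
      obtain ⟨p, ⟨hp, hpa⟩, rfl⟩ := hx
      obtain ⟨q, ⟨hq, hqa⟩, rfl⟩ := hy
      exact (lt_iff_lt_of_cmp_eq_cmp (s.prop.1 _ hp _ hq)).1 (hpa.trans hqa))
  have hcmp : ∀ p ∈ s.val, cmp p.1 a = cmp p.2 b := by
    intro p hp
    rcases lt_trichotomy p.1 a with hl | he | hg
    · have := hlo p.2 (Finset.mem_image.2 ⟨p, Finset.mem_filter.2 ⟨hp, hl⟩, rfl⟩)
      rw [(cmp_eq_lt_iff _ _).2 hl, (cmp_eq_lt_iff _ _).2 this]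
    · exact (hm ⟨p.2, he ▸ hp⟩).elim
    · have := hhi p.2 (Finset.mem_image.2 ⟨p, Finset.mem_filter.2 ⟨hp, hg⟩, rfl⟩)
      rw [(cmp_eq_gt_iff _ _).2 hg, (cmp_eq_gt_iff _ _).2 this]
  refine ⟨⟨insert (a, b) s.val, ?_, ?_⟩, ⟨b, Finset.mem_insert_self _ _⟩,
    Finset.subset_insert _ _⟩
  · intro p hp q hq
    rw [Finset.mem_insert] at hp hq
    rcases hp with rfl | hp <;> rcases hq with rfl | hq
    · simp only [cmp_self_eq_eq]
    · rw [cmp_eq_cmp_symm]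
      exact hcmp _ hq
    · exact hcmp _ hp
    · exact s.prop.1 _ hp _ hq
  · intro p hp
    rcases Finset.mem_insert.1 hp with rfl | hp
    · exact hb.symm
    · exact s.prop.2 _ hp

theorem exists_insert_right (h : RealizesColors f g) (s : ColoredPartialIso f g) (b : β) :
    ∃ t : ColoredPartialIso f g, (∃ a, (a, b) ∈ t.val) ∧ s ≤ t := by
  classical
  let swap {γ δ : Type} [LinearOrder γ] [LinearOrder δ] {f' : γ → κ} {g' : δ → κ}
      (s : ColoredPartialIso f' g') : ColoredPartialIso g' f' :=
    ⟨s.val.map (Equiv.prodComm γ δ).toEmbedding, by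
      simp only [Finset.mem_map_equiv]
      exact ⟨fun p hp q hq => (s.prop.1 _ hp _ hq).symm, fun p hp => (s.prop.2 _ hp).symm⟩⟩
  obtain ⟨t, ⟨a, ha⟩, hst⟩ := exists_insert_left h (swap s) b
  refine ⟨swap t, ⟨a, Finset.mem_map_equiv.2 ha⟩, fun p hp => Finset.mem_map_equiv.2 (hst ?_)⟩
  exact Finset.mem_map_equiv.2 hp

end ColoredPartialIso

/-- The coloured version of Cantor's isomorphism theorem. -/
theorem exists_orderIso_of_realizesColors [Countable α] [Countable β] {f : α → κ} {g : β → κ}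
    (hf : RealizesColors f g) (hg : RealizesColors g f) :
    ∃ e : α ≃o β, ∀ a, g (e a) = f a := by
  classical
  cases nonempty_encodable α
  cases nonempty_encodable β
  -- An ideal meeting these countably many cofinal sets is a directed family of partial maps that is
  -- total on both sides.
  let C : α ⊕ β → Order.Cofinal (ColoredPartialIso f g) := fun p => Sum.recOn p
    (fun a => ⟨{t | ∃ b, (a, b) ∈ t.val}, fun s => ColoredPartialIso.exists_insert_left hg s a⟩)
    (fun b => ⟨{t | ∃ a, (a, b) ∈ t.val}, fun s => ColoredPartialIso.exists_insert_right hf s b⟩)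
  let I := Order.idealOfCofinals (default : ColoredPartialIso f g) C
  have hF : ∀ a, ∃ b, ∃ t ∈ I, (a, b) ∈ t.val := fun a => by
    obtain ⟨t, ⟨b, hb⟩, ht⟩ := Order.cofinal_meets_idealOfCofinals default C (Sum.inl a)
    exact ⟨b, t, ht, hb⟩
  have hG : ∀ b, ∃ a, ∃ t ∈ I, (a, b) ∈ t.val := fun b => by
    obtain ⟨t, ⟨a, ha⟩, ht⟩ := Order.cofinal_meets_idealOfCofinals default C (Sum.inr b)
    exact ⟨a, t, ht, ha⟩
  choose F hF using hF
  choose G hG using hG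
  refine ⟨OrderIso.ofCmpEqCmp F G fun a b => ?_, fun a => ?_⟩
  · obtain ⟨s, hs, ha⟩ := hF a
    obtain ⟨t, ht, hb⟩ := hG b
    obtain ⟨m, -, sm, tm⟩ := I.directed _ hs _ ht
    exact m.prop.1 (a, _) (sm ha) (_, b) (tm hb)
  · obtain ⟨s, -, ha⟩ := hF a
    exact (s.prop.2 _ ha).symm

end ColoredOrder

/-! ### Shuffles and their isomorphism types -/

theorem Dense.exists_between_finsets {s : Set ℚ} (hs : Dense s) (lo hi : Finset ℚ)
    (h : ∀ x ∈ lo, ∀ y ∈ hi, x < y) : ∃ a ∈ s, (∀ x ∈ lo, x < a) ∧ ∀ y ∈ hi, a < y := by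
  obtain ⟨m, hlo, hhi⟩ := Order.exists_between_finsets lo hi h
  -- A second separating point gives a nonempty open interval `(m, m')` inside the cut, where
  -- density of `s` applies.
  obtain ⟨m', hlo', hhi'⟩ := Order.exists_between_finsets (insert m lo) hi (by
    simp only [Finset.mem_insert, forall_eq_or_imp]
    exact ⟨hhi, h⟩)
  obtain ⟨a, ha, h1, h2⟩ := hs.exists_between (hlo' m (by simp))
  exact ⟨a, ha, fun x hx => (hlo x hx).trans h1, fun y hy => h2.trans (hhi' y hy)⟩

namespace CompEmb

/-- The suborder of `ω·η` in which the copy of `ω` at `q` is cut down to its first `c q`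
elements. -/
abbrev Cut (c : ℚ → ℕ∞) : Type := {x : ℚ ×ₗ ℕ // ((ofLex x).2 : ℕ∞) < c (ofLex x).1}

/-- The values `1, …, d` and `∞` are taken densely, and there are no others but `0`. -/
structure IsShuffleMap (d : ℕ) (c : ℚ → ℕ∞) : Prop where
  le_or_top : ∀ q, c q ≤ d ∨ c q = ⊤
  dense_nat : ∀ n : ℕ, 1 ≤ n → n ≤ d → Dense {q | c q = n}
  dense_top : Dense {q | c q = ⊤}

namespace IsShuffleMap

variable {d : ℕ} {c c' : ℚ → ℕ∞}

theorem dense_fiber (h : IsShuffleMap d c) {n : ℕ∞} (h0 : n ≠ 0) (hn : n ≤ d ∨ n = ⊤) :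
    Dense {q | c q = n} := by
  induction n using ENat.recTopCoe with
  | top => exact h.dense_top
  | coe n =>
    refine h.dense_nat n ?_ ?_
    · exact Nat.one_le_iff_ne_zero.2 fun e => h0 (by simp [e])
    · rcases hn with hn | hn
      · exact_mod_cast hn
      · exact absurd hn (ENat.natCast_ne_top n)

/-- Empty blocks are dropped because the value `0` need not be dense; every remaining value is, so
any finite cut contains it. -/
theorem realizesColors (h : IsShuffleMap d c) (h' : IsShuffleMap d c') :
    RealizesColors (fun q : {q // c q ≠ 0} => c q) (fun q : {q // c' q ≠ 0} => c' q) := by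
  intro b lo hi hlh
  obtain ⟨a, ha, hlo, hhi⟩ := (h.dense_fiber b.2 (h'.le_or_top b)).exists_between_finsets
    (lo.map (Function.Embedding.subtype _)) (hi.map (Function.Embedding.subtype _)) (by
      simp only [Finset.mem_map, Function.Embedding.coe_subtype]
      rintro _ ⟨x, hx, rfl⟩ _ ⟨y, hy, rfl⟩
      exact hlh x hx y hy)
  refine ⟨⟨a, ?_⟩, ha, fun x hx => hlo x ?_, fun y hy => hhi y ?_⟩
  · have ha : c a = c' b := ha
    exact ha ▸ b.2
  · exact Finset.mem_map_of_mem _ hx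
  · exact Finset.mem_map_of_mem _ hy

theorem Cut.ne_zero (x : Cut c) : c (ofLex x.1).1 ≠ 0 := fun h => by
  have := x.2
  simp [h] at this

theorem nonempty_orderIso (h : IsShuffleMap d c) (h' : IsShuffleMap d c') :
    Nonempty (Cut c ≃o Cut c') := by
  obtain ⟨e, he⟩ := exists_orderIso_of_realizesColors (h.realizesColors h') (h'.realizesColors h)
  have he' : ∀ q, c (e.symm q) = c' q := fun q => by
    have := he (e.symm q)
    simpa using this.symm
  refine ⟨⟨⟨fun x => ⟨toLex ((e ⟨(ofLex x.1).1, Cut.ne_zero x⟩ : ℚ), (ofLex x.1).2), ?_⟩,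
    fun x => ⟨toLex ((e.symm ⟨(ofLex x.1).1, Cut.ne_zero x⟩ : ℚ), (ofLex x.1).2), ?_⟩,
    fun x => ?_, fun x => ?_⟩, ?_⟩⟩
  · have := he ⟨(ofLex x.1).1, Cut.ne_zero x⟩
    simp only [ofLex_toLex] at this ⊢
    rw [this]
    exact x.2
  · have := he' ⟨(ofLex x.1).1, Cut.ne_zero x⟩
    simp only [ofLex_toLex] at this ⊢
    rw [this]
    exact x.2
  · apply Subtype.ext
    simp
  · apply Subtype.ext
    simp
  · intro x y
    simp only [Equiv.coe_fn_mk, Subtype.mk_le_mk, Prod.Lex.toLex_le_toLex]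
    rw [← Subtype.coe_le_coe, Prod.Lex.le_iff, Subtype.coe_lt_coe, e.lt_iff_lt, Subtype.coe_inj,
      e.injective.eq_iff]
    simp

/-- Between different positions lies a whole copy of `ω`, whereas within a block an interval is
bounded by offsets. So the blocks are definable from the order alone. -/
theorem finite_uIcc_iff (h : IsShuffleMap d c) (x y : Cut c) :
    (Set.uIcc x y).Finite ↔ (ofLex x.1).1 = (ofLex y.1).1 := by
  wlog hxy : x ≤ y generalizing x y
  · rw [Set.uIcc_comm, this y x (le_of_not_ge hxy), eq_comm]
  rw [Set.uIcc_of_le hxy]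
  constructor
  · intro hfin
    by_contra hne
    have hlt : (ofLex x.1).1 < (ofLex y.1).1 := by
      rcases Prod.Lex.le_iff.1 (show x.1 ≤ y.1 from hxy) with h | h
      · exact h
      · exact absurd h.1 hne
    obtain ⟨r, hr, h1, h2⟩ := h.dense_top.exists_between hlt
    refine Set.infinite_of_injective_forall_mem
      (f := fun k : ℕ => (⟨toLex (r, k), by simp [show c r = ⊤ from hr]⟩ : Cut c)) ?_ ?_ hfin
    · intro k l hkl
      exact congrArg (fun z : Cut c => (ofLex z.1).2) hkl
    · intro k
      exact ⟨Prod.Lex.le_iff.2 (Or.inl h1), Prod.Lex.le_iff.2 (Or.inl h2)⟩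
  · intro heq
    refine Set.Finite.subset (Set.Finite.preimage (f := fun z : Cut c => ofLex z.1) ?_
      ((Set.finite_singleton (ofLex x.1).1).prod (Set.finite_Iic (ofLex y.1).2))) ?_
    · intro z _ w _ hzw
      exact Subtype.ext hzw
    · rintro z ⟨hxz, hzy⟩
      have h1 := Prod.Lex.le_iff.1 (show x.1 ≤ z.1 from hxz)
      have h2 := Prod.Lex.le_iff.1 (show z.1 ≤ y.1 from hzy)
      have hz : (ofLex z.1).1 = (ofLex x.1).1 := by
        rcases h1 with h1 | h1
        · rcases h2 with h2 | h2
          · exact absurd (h1.trans h2) (by simp [heq])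
          · exact h2.1.trans heq.symm
        · exact h1.1.symm
      refine ⟨hz, ?_⟩
      rcases h2 with h2 | h2
      · rw [hz, heq] at h2
        exact absurd h2 (lt_irrefl _)
      · exact h2.2

/-- The block of `x`, consisting of the elements finitely far away, has as many elements as the
map says. -/
theorem encard_block (h : IsShuffleMap d c) (x : Cut c) :
    {y : Cut c | (Set.uIcc x y).Finite}.encard = c (ofLex x.1).1 := by
  have himg : {y : Cut c | (Set.uIcc x y).Finite} =
      Set.range (fun k : {k : ℕ // (k : ℕ∞) < c (ofLex x.1).1} =>
        (⟨toLex ((ofLex x.1).1, k.1), k.2⟩ : Cut c)) := by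
    ext y
    simp only [Set.mem_ofPred_eq, h.finite_uIcc_iff, Set.mem_range]
    constructor
    · intro hxy
      exact ⟨⟨(ofLex y.1).2, hxy ▸ y.2⟩, Subtype.ext (by simp [hxy])⟩
    · rintro ⟨k, rfl⟩
      rfl
  rw [himg, ← Set.image_univ, Function.Injective.encard_image, Set.encard_univ]
  · generalize c (ofLex x.1).1 = n
    induction n using ENat.recTopCoe with
    | top =>
      simp only [ENat.natCast_lt_top]
      rw [ENat.card_congr (Equiv.subtypeUnivEquiv fun _ => trivial)]
      simp
    | coe n =>
      simp only [Nat.cast_lt]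
      rw [ENat.card_congr (Fin.equivSubtype (n := n)).symm]
      simp
  · intro k l hkl
    have := congrArg (fun z : Cut c => (ofLex z.1).2) hkl
    exact Subtype.ext this

/-- A block of size `d'` is carried back to a block of the same finite size, which cannot exceed
`d`. -/
theorem le_of_orderIso {d' : ℕ} (h : IsShuffleMap d c) (h' : IsShuffleMap d' c')
    (e : Cut c ≃o Cut c') : d' ≤ d := by
  rcases Nat.eq_zero_or_pos d' with rfl | hpos
  · exact Nat.zero_le _
  obtain ⟨q, hq⟩ := (h'.dense_nat d' hpos le_rfl).nonempty
  let y : Cut c' := ⟨toLex (q, 0), by simpa [show c' q = d' from hq] using hpos⟩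
  have hy : {z : Cut c' | (Set.uIcc y z).Finite}.encard = d' :=
    (h'.encard_block y).trans hq
  have hset : {z : Cut c' | (Set.uIcc y z).Finite} =
      e '' {z : Cut c | (Set.uIcc (e.symm y) z).Finite} := by
    ext z
    rw [e.image_eq_preimage_symm, Set.mem_preimage, Set.mem_ofPred_eq, Set.mem_ofPred_eq]
    have : Set.uIcc (e.symm y) (e.symm z) = e.symm '' Set.uIcc y z := by
      simp [Set.uIcc]
    rw [this, Set.finite_image_iff e.symm.injective.injOn]
  rw [hset, e.injective.encard_image, h.encard_block] at hy
  rcases h.le_or_top (ofLex (e.symm y).1).1 with hle | htop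
  · rw [hy] at hle
    exact_mod_cast hle
  · rw [hy] at htop
    exact absurd htop (ENat.natCast_ne_top d')

end IsShuffleMap

open FirstOrder FirstOrder.Language

theorem IsShuffle.exists_cut {d : ℕ} {B : NatStructure FirstOrder.Language.order}
    (h : IsShuffle d B) : ∃ c, IsShuffleMap d c ∧ ∃ e : B.carrier ≃ Cut c, ∀ x y : B.carrier,
      Structure.RelMap (leSymb : FirstOrder.Language.order.Relations 2) ![x, y] ↔ e x ≤ e y := by
  obtain ⟨c, h1, h2, h3, e, he⟩ := h
  exact ⟨c, ⟨h1, h2, h3⟩, e, he⟩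

/-- Isomorphisms of structures for the language of orders. -/
theorem isomorphic_iff_exists_equiv {B B' : NatStructure FirstOrder.Language.order} :
    Isomorphic B B' ↔ ∃ e : B.carrier ≃ B'.carrier, ∀ x y,
      Structure.RelMap (leSymb : FirstOrder.Language.order.Relations 2) ![e x, e y] ↔
        Structure.RelMap (leSymb : FirstOrder.Language.order.Relations 2) ![x, y] := by
  constructor
  · rintro ⟨e⟩
    refine ⟨e.toEquiv, fun x y => ?_⟩
    rw [← e.map_rel leSymb]
    refine iff_of_eq (congrArg _ (funext fun i => ?_))
    fin_cases i <;> rfl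
  · rintro ⟨e, he⟩
    refine ⟨⟨e, fun f => Empty.elim f, fun R v => ?_⟩⟩
    cases R
    have := he (v 0) (v 1)
    have h1 : ![v 0, v 1] = v := by
      ext i
      fin_cases i <;> rfl
    have h2 : ![e (v 0), e (v 1)] = e ∘ v := by
      ext i
      fin_cases i <;> rfl
    rw [h1, h2] at this
    exact this

theorem IsShuffle.isomorphic {d : ℕ} {B B' : NatStructure FirstOrder.Language.order}
    (h : IsShuffle d B) (h' : IsShuffle d B') : Isomorphic B B' := by
  obtain ⟨c, hc, e, he⟩ := h.exists_cut
  obtain ⟨c', hc', e', he'⟩ := h'.exists_cut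
  obtain ⟨i⟩ := hc.nonempty_orderIso hc'
  refine isomorphic_iff_exists_equiv.2 ⟨(e.trans i.toEquiv).trans e'.symm, fun x y => ?_⟩
  rw [he, he']
  simp

theorem IsShuffle.eq_of_isomorphic {d d' : ℕ} {B B' : NatStructure FirstOrder.Language.order}
    (h : IsShuffle d B) (h' : IsShuffle d' B') (hi : Isomorphic B B') : d = d' := by
  obtain ⟨c, hc, e, he⟩ := h.exists_cut
  obtain ⟨c', hc', e', he'⟩ := h'.exists_cut
  obtain ⟨i, hi⟩ := isomorphic_iff_exists_equiv.1 hi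
  let j : Cut c ≃o Cut c' := ⟨(e.symm.trans i).trans e', fun {x y} => by
    simp only [Equiv.trans_apply]
    rw [← he', hi, he]
    simp⟩
  exact le_antisymm (hc'.le_of_orderIso hc j.symm) (hc.le_of_orderIso hc' j)

end CompEmb

/-! ### Projections of primitive recursive relations -/

theorem REPred.exists {α β : Type*} [Primcodable α] [Primcodable β] {R : α → β → Prop}
    (hR : PrimrecRel R) : REPred fun a => ∃ b, R a b := by
  classical
  have hf : Primrec₂ fun (a : α) (n : ℕ) =>
      (Encodable.decode (α := β) n).bind fun b => if R a b then some b else none :=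
    Primrec.bind_decode_iff.2 (Primrec.ite hR (Primrec.option_some.comp Primrec.snd)
      (Primrec.const none))
  refine (Partrec.rfindOpt hf.to_comp).dom_re.of_eq fun a => ?_
  rw [Nat.rfindOpt_dom]
  constructor
  · rintro ⟨n, b, hb⟩
    simp only [Option.mem_def, Option.bind_eq_some_iff] at hb
    obtain ⟨b', -, hb⟩ := hb
    by_cases h : R a b'
    · exact ⟨b', h⟩
    · simp [h] at hb
  · rintro ⟨b, hb⟩
    exact ⟨Encodable.encode b, b, by simp [hb]⟩

namespace CompEmb

/-! ### A primitive recursive coding of the points of `ω·η` -/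

section Order

/-- The rational number at which the block with the given parameters is placed. -/
def position (a n : ℕ) : ℚ := (2 * a + 1) / 2 ^ n - n

/-- Clearing denominators and moving the negative terms across leaves a comparison of natural
numbers, which is visibly primitive recursive. -/
theorem position_le_iff (a n b m : ℕ) : position a n ≤ position b m ↔
    (2 * a + 1) * 2 ^ m + m * (2 ^ n * 2 ^ m) ≤ (2 * b + 1) * 2 ^ n + n * (2 ^ n * 2 ^ m) := by
  have hn : (0 : ℚ) < 2 ^ n := by positivity
  have hm : (0 : ℚ) < 2 ^ m := by positivity
  rw [← @Nat.cast_le ℚ, ← mul_le_mul_iff_of_pos_right (mul_pos hn hm), position, position]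
  have h1 : ((2 * a + 1 : ℚ) / 2 ^ n - n) * (2 ^ n * 2 ^ m) =
      (2 * a + 1) * 2 ^ m - n * (2 ^ n * 2 ^ m) := by
    field_simp
  have h2 : ((2 * b + 1 : ℚ) / 2 ^ m - m) * (2 ^ n * 2 ^ m) =
      (2 * b + 1) * 2 ^ n - m * (2 ^ n * 2 ^ m) := by
    field_simp
  rw [h1, h2]
  push_cast
  constructor <;> intro h <;> linarith

/-- The odd numerator puts the fraction in lowest terms and the integer shift leaves its denominator
alone, so the level is determined, and then the mantissa. -/
theorem position_inj {a n b m : ℕ} (h : position a n = position b m) : a = b ∧ n = m := by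
  wlog hnm : n ≤ m generalizing a n b m
  · have := this h.symm (le_of_not_ge hnm)
    exact ⟨this.1.symm, this.2.symm⟩
  have heq : (2 * a + 1) * 2 ^ m + m * (2 ^ n * 2 ^ m) =
      (2 * b + 1) * 2 ^ n + n * (2 ^ n * 2 ^ m) :=
    le_antisymm ((position_le_iff a n b m).1 h.le) (by
      have := (position_le_iff b m a n).1 h.ge
      rwa [mul_comm (2 ^ m) (2 ^ n)] at this)
  obtain ⟨r, rfl⟩ := Nat.exists_eq_add_of_le hnm
  have hpos : 0 < 2 ^ n := by positivity
  have heq' : (2 * a + 1) * 2 ^ r + (n + r) * (2 ^ n * 2 ^ r) =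
      (2 * b + 1) + n * (2 ^ n * 2 ^ r) := by
    apply Nat.eq_of_mul_eq_mul_left hpos
    rw [pow_add] at heq
    linarith
  cases r with
  | zero =>
    simp only [pow_zero, mul_one, add_zero] at heq'
    exact ⟨by omega, rfl⟩
  | succ r =>
    exfalso
    -- For different levels the two sides have opposite parity.
    have : 2 * ((2 * a + 1) * 2 ^ r + (n + (r + 1)) * (2 ^ n * 2 ^ r)) =
        2 * (b + n * (2 ^ n * 2 ^ r)) + 1 := by
      rw [pow_succ] at heq'
      linarith
    omega

/-- The list of natural numbers attached to a level. -/
def levelTuple (n : ℕ) : List ℕ := (Encodable.decode n.unpair.1 : Option (List ℕ)).getD []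

theorem dense_position (t : List ℕ) :
    Dense {q | ∃ a n, levelTuple n = t ∧ q = position a n} := by
  refine dense_of_exists_between fun p q hpq => ?_
  -- At a level `n ≥ r` the positions start near `-n`, left of `p`, and their spacing `2 / 2 ^ n` is
  -- less than `q - p`.
  obtain ⟨r, hr⟩ := exists_nat_gt (max (-p) (2 / (q - p)))
  have hr1 : -p < r := (le_max_left _ _).trans_lt hr
  have hr2 : 2 / (q - p) < r := (le_max_right _ _).trans_lt hr
  -- The first component fixes the tuple; the second makes the level as large as needed.
  set n := Nat.pair (Encodable.encode t) r with hn
  have hrn : (r : ℚ) ≤ n := by exact_mod_cast Nat.right_le_pair _ _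
  have hpow : (n : ℚ) < 2 ^ n := by exact_mod_cast n.lt_two_pow_self
  have hpos : (0 : ℚ) < 2 ^ n := by positivity
  have h2 : 2 < (q - p) * 2 ^ n := by
    rw [div_lt_iff₀ (sub_pos.2 hpq)] at hr2
    nlinarith [sub_pos.2 hpq]
  set y : ℚ := (p + n) * 2 ^ n with hy
  have hy0 : 0 ≤ y := mul_nonneg (by linarith) hpos.le
  -- The least `a` with `2 * a + 1 > y`, that is, the first position of level `n` beyond `p`.
  set a := ⌊(y + 1) / 2⌋₊ with ha
  have ha1 : (a : ℚ) ≤ (y + 1) / 2 := Nat.floor_le (by linarith)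
  have ha2 : (y + 1) / 2 < a + 1 := Nat.lt_floor_add_one _
  refine ⟨position a n, ⟨a, n, ?_, rfl⟩, ?_, ?_⟩
  · simp [levelTuple, hn]
  · rw [position, lt_sub_iff_add_lt, lt_div_iff₀ hpos]
    linarith
  · rw [position, sub_lt_iff_lt_add, div_lt_iff₀ hpos]
    nlinarith

/-- The mantissa of an element, which together with its level determines the position of its
block. -/
def mantissa (x : ℕ) : ℕ := x.unpair.1.unpair.1

/-- The level of an element, which together with its mantissa determines the position of its
block. -/
def level (x : ℕ) : ℕ := x.unpair.1.unpair.2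

/-- The place of an element in its block. -/
def offset (x : ℕ) : ℕ := x.unpair.2

/-- The point of `ω·η` coded by `x`. -/
def point (x : ℕ) : ℚ ×ₗ ℕ := toLex (position (mantissa x) (level x), offset x)

theorem point_injective : Function.Injective point := by
  intro x y h
  have h' := toLex.injective h
  obtain ⟨h1, h2⟩ := Prod.mk.inj h'
  obtain ⟨h3, h4⟩ := position_inj h1
  rw [← Nat.pair_unpair x, ← Nat.pair_unpair y, ← Nat.pair_unpair x.unpair.1,
    ← Nat.pair_unpair y.unpair.1]
  exact congrArg₂ _ (congrArg₂ _ h3 h4) h2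

theorem exists_point_eq (a n k : ℕ) :
    ∃ x, mantissa x = a ∧ level x = n ∧ offset x = k :=
  ⟨Nat.pair (Nat.pair a n) k, by simp [mantissa, level, offset]⟩

/-- The tuple attached to the block of `x`. -/
def tuple (x : ℕ) : List ℕ := levelTuple (level x)

theorem primrec_tuple : Primrec tuple := by
  have h : Primrec fun x : ℕ => x.unpair.1.unpair.2.unpair.1 :=
    Primrec.fst.comp (Primrec.unpair.comp (Primrec.snd.comp (Primrec.unpair.comp
      (Primrec.fst.comp Primrec.unpair))))
  exact Primrec.option_getD.comp ((Primrec.decode (α := List ℕ)).comp h) (Primrec.const [])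

theorem primrec_offset : Primrec offset := Primrec.snd.comp Primrec.unpair

theorem primrec_level : Primrec level :=
  Primrec.snd.comp (Primrec.unpair.comp (Primrec.fst.comp Primrec.unpair))

theorem primrec_mantissa : Primrec mantissa :=
  Primrec.fst.comp (Primrec.unpair.comp (Primrec.fst.comp Primrec.unpair))

theorem primrecRel_position_le : PrimrecRel fun x y : ℕ =>
    position (mantissa x) (level x) ≤ position (mantissa y) (level y) := by
  have hpow : Primrec fun n : ℕ => 2 ^ n :=
    (Primrec₂.unpaired'.1 Nat.Primrec.pow).comp (Primrec.const 2) Primrec.id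
  have ha : Primrec fun p : ℕ × ℕ => mantissa p.1 := primrec_mantissa.comp Primrec.fst
  have hb : Primrec fun p : ℕ × ℕ => mantissa p.2 := primrec_mantissa.comp Primrec.snd
  have hn : Primrec fun p : ℕ × ℕ => level p.1 := primrec_level.comp Primrec.fst
  have hm : Primrec fun p : ℕ × ℕ => level p.2 := primrec_level.comp Primrec.snd
  have hprod := Primrec.nat_mul.comp (hpow.comp hn) (hpow.comp hm)
  have hl := Primrec.nat_add.comp (Primrec.nat_mul.comp (Primrec.nat_double_succ.comp ha)
    (hpow.comp hm)) (Primrec.nat_mul.comp hm hprod)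
  have hr := Primrec.nat_add.comp (Primrec.nat_mul.comp (Primrec.nat_double_succ.comp hb)
    (hpow.comp hn)) (Primrec.nat_mul.comp hn hprod)
  exact (Primrec.nat_le.comp hl hr).of_eq fun p => (position_le_iff _ _ _ _).symm

theorem primrecRel_point_le : PrimrecRel fun x y : ℕ => point x ≤ point y := by
  have h1 := primrecRel_position_le
  have h2 : PrimrecRel fun x y : ℕ =>
      position (mantissa y) (level y) ≤ position (mantissa x) (level x) :=
    PrimrecRel.swap h1
  have h3 : PrimrecRel fun x y : ℕ => offset x ≤ offset y :=
    PrimrecRel.comp Primrec.nat_le (primrec_offset.comp Primrec.fst)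
      (primrec_offset.comp Primrec.snd)
  -- The strict part of the lexicographic order is expressed as failure of the reverse inequality.
  refine PrimrecPred.of_eq (h1.and (h2.not.or h3)) fun p => ?_
  change _ ↔ toLex _ ≤ toLex _
  rw [Prod.Lex.toLex_le_toLex]
  dsimp only
  rw [lt_iff_le_and_ne]
  constructor
  · rintro ⟨h, h'⟩
    rcases h.lt_or_eq with hl | he
    · exact Or.inl ⟨h, hl.ne⟩
    · exact Or.inr ⟨he, h'.resolve_left (not_not_intro he.ge)⟩
  · rintro (h | h)
    · exact ⟨h.1, Or.inl (lt_of_le_of_ne h.1 h.2).not_ge⟩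
    · exact ⟨h.1.le, Or.inr h.2⟩

end Order

/-! ### Certificates and the enumeration operator -/

section Certificates

open FirstOrder FirstOrder.Language

/-- Evidence that a number codes an element of the constructed order. The entry `(x, j, L)`
concerns the number `x` with attached tuple `t`; the list `L` of triples `(s, w, u)` describes a
computation of partial sums `u` of multiples `w = s • t` which ends with the `j`-th entry of
`t`. -/
abbrev Certificate : Type := ℕ × ℕ × List (ℕ × ℕ × ℕ)

namespace Certificate

def entry (c : Certificate) (i : ℕ) : ℕ := (tuple c.1).getD i 0

/-- The default triple for a list that is too short is harmless: soundness uses only the facts being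
true and the final equality. -/
def coeff (c : Certificate) (i : ℕ) : ℕ := (c.2.2.getD i (0, 0, 0)).1

def term (c : Certificate) (i : ℕ) : ℕ := (c.2.2.getD i (0, 0, 0)).2.1

def partialSum (c : Certificate) (i : ℕ) : ℕ := (c.2.2.getD i (0, 0, 0)).2.2

/-- The first alternative covers the points present whether or not the tuple is dependent; the
second says that the sum of multiples of entries before the `j`-th is that entry. Distinct numbers
name distinct elements, so this equality is checked on numbers and needs no literal. -/
def Valid (c : Certificate) : Prop :=
  offset c.1 < (tuple c.1).length ∨
    c.2.1 < (tuple c.1).length ∧ c.partialSum c.2.1 = c.entry c.2.1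

/-- The positive facts which certify that `c.1` is an element. -/
def facts (c : Certificate) : List (Literal vsLang) :=
  (tuple c.1).map (fun x => (true, .rel VSRel.isVector ![x])) ++
    if offset c.1 < (tuple c.1).length then [] else
      (true, .rel VSRel.zeroV ![c.partialSum 0]) :: (List.range c.2.1).flatMap fun i =>
        [(true, .rel VSRel.smulV ![c.coeff i, c.entry i, c.term i]),
          (true, .rel VSRel.addV ![c.partialSum i, c.term i, c.partialSum (i + 1)])]

def factCodes (c : Certificate) : List LitCode :=
  (tuple c.1).map (fun x => (true, 1, [x])) ++
    if offset c.1 < (tuple c.1).length then [] else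
      (true, 7, [c.partialSum 0]) :: (List.range c.2.1).flatMap fun i =>
        [(true, 9, [c.coeff i, c.entry i, c.term i]),
          (true, 8, [c.partialSum i, c.term i, c.partialSum (i + 1)])]

theorem map_code_facts (c : Certificate) : c.facts.map Literal.code = c.factCodes := by
  rw [facts, factCodes, List.map_append, List.map_map]
  congr 1
  split_ifs
  · rfl
  · rw [List.map_cons, List.map_flatMap]
    rfl

theorem exists_rel_of_mem_facts {c : Certificate} {ψ : Literal vsLang} (h : ψ ∈ c.facts) :
    ∃ (n : ℕ) (R : vsLang.Relations n) (v : Fin n → ℕ), ψ = (true, .rel R v) := by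
  rw [facts, List.mem_append] at h
  rcases h with h | h
  · obtain ⟨x, -, rfl⟩ := List.mem_map.1 h
    exact ⟨_, _, _, rfl⟩
  · split_ifs at h
    · simp at h
    · simp only [List.mem_cons, List.mem_flatMap, List.not_mem_nil, or_false] at h
      rcases h with rfl | ⟨i, -, rfl | rfl⟩ <;> exact ⟨_, _, _, rfl⟩

theorem primrec_entry : Primrec₂ entry :=
  (Primrec.list_getD 0).comp (primrec_tuple.comp (Primrec.fst.comp Primrec.fst)) Primrec.snd

theorem primrec_triple : Primrec₂ fun (c : Certificate) (i : ℕ) => c.2.2.getD i (0, 0, 0) :=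
  (Primrec.list_getD (0, 0, 0)).comp (Primrec.snd.comp (Primrec.snd.comp Primrec.fst)) Primrec.snd

theorem primrec_coeff : Primrec₂ coeff := Primrec.fst.comp primrec_triple

theorem primrec_term : Primrec₂ term := Primrec.fst.comp (Primrec.snd.comp primrec_triple)

theorem primrec_partialSum : Primrec₂ partialSum :=
  Primrec.snd.comp (Primrec.snd.comp primrec_triple)

theorem primrecPred_valid : PrimrecPred Valid := by
  have hlen : Primrec fun c : Certificate => (tuple c.1).length :=
    Primrec.list_length.comp (primrec_tuple.comp Primrec.fst)
  have hj : Primrec fun c : Certificate => c.2.1 := Primrec.fst.comp Primrec.snd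
  exact (Primrec.nat_lt.comp (primrec_offset.comp Primrec.fst) hlen).or
    ((Primrec.nat_lt.comp hj hlen).and
      (Primrec.eq.comp (primrec_partialSum.comp Primrec.id hj)
        (primrec_entry.comp Primrec.id hj)))

theorem primrec_list_triple {α : Type*} [Primcodable α] {f g h : α → ℕ} (hf : Primrec f)
    (hg : Primrec g) (hh : Primrec h) : Primrec fun a => [f a, g a, h a] :=
  Primrec.list_cons.comp hf (Primrec.list_cons.comp hg
    (Primrec.list_cons.comp hh (Primrec.const [])))

theorem primrec_litCode {α : Type*} [Primcodable α] (k : ℕ) {f : α → List ℕ} (hf : Primrec f) :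
    Primrec fun a => ((true, k, f a) : LitCode) :=
  (Primrec.const true).pair ((Primrec.const k).pair hf)

theorem primrec_factCodes : Primrec factCodes := by
  have htup : Primrec fun c : Certificate => tuple c.1 := primrec_tuple.comp Primrec.fst
  have hoff : Primrec fun c : Certificate => offset c.1 := primrec_offset.comp Primrec.fst
  have hj : Primrec fun c : Certificate => c.2.1 := Primrec.fst.comp Primrec.snd
  refine Primrec.list_append.comp (Primrec.list_map htup (primrec_litCode 1
    (Primrec.list_cons.comp Primrec.snd (Primrec.const [])))) (Primrec.ite
      (Primrec.nat_lt.comp hoff (Primrec.list_length.comp htup)) (Primrec.const [])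
      (Primrec.list_cons.comp (primrec_litCode 7 (Primrec.list_cons.comp
        (primrec_partialSum.comp Primrec.id (Primrec.const 0)) (Primrec.const [])))
        (Primrec.list_flatMap (Primrec.list_range.comp hj) ?_)))
  refine Primrec.list_cons.comp (primrec_litCode 9 (primrec_list_triple primrec_coeff primrec_entry
    primrec_term)) (Primrec.list_cons.comp (primrec_litCode 8 (primrec_list_triple primrec_partialSum
      primrec_term ?_)) (Primrec.const []))
  exact primrec_partialSum.comp Primrec.fst (Primrec.succ.comp Primrec.snd)

end Certificate

open Classical in
/-- The literal about two certified elements: an equality if `b` is true, and otherwise an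
inequality in the order. -/
noncomputable def outLiteral (b : Bool) (x y : ℕ) : Literal FirstOrder.Language.order :=
  bif b then (decide (x = y), .eq x y)
  else (decide (point x ≤ point y), .rel leSymb ![x, y])

/-- The enumeration operator. -/
def shuffleOperator : Set (Finset (Literal vsLang) × Literal FirstOrder.Language.order) :=
  {p | ∃ (b : Bool) (c c' : Certificate), c.Valid ∧ c'.Valid ∧
    (∀ ψ, ψ ∈ p.1 ↔ ψ ∈ c.facts ++ c'.facts) ∧ p.2 = outLiteral b c.1 c'.1}

theorem primrec_code_outLiteral : Primrec fun p : Bool × ℕ × ℕ =>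
    (outLiteral p.1 p.2.1 p.2.2).code := by
  classical
  have hx : Primrec fun p : Bool × ℕ × ℕ => p.2.1 := Primrec.fst.comp Primrec.snd
  have hy : Primrec fun p : Bool × ℕ × ℕ => p.2.2 := Primrec.snd.comp Primrec.snd
  have hl : Primrec fun p : Bool × ℕ × ℕ => [p.2.1, p.2.2] :=
    Primrec.list_cons.comp hx (Primrec.list_cons.comp hy (Primrec.const []))
  refine (Primrec.cond Primrec.fst
    ((Primrec.eq.comp hx hy).decide.pair ((Primrec.const 0).pair hl))
    ((primrecRel_point_le.comp hx hy).decide.pair ((Primrec.const 1).pair hl))).of_eq ?_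
  rintro ⟨b, x, y⟩
  cases b <;> rfl

theorem isCE_shuffleOperator : IsCE shuffleOperator := by
  classical
  let codes : Bool × Certificate × Certificate → List LitCode := fun D =>
    D.2.1.factCodes ++ D.2.2.factCodes
  have hcodes : Primrec codes := Primrec.list_append.comp
    (Certificate.primrec_factCodes.comp (Primrec.fst.comp Primrec.snd))
    (Certificate.primrec_factCodes.comp (Primrec.snd.comp Primrec.snd))
  have hmap : ∀ c c' : Certificate, ∀ x, x ∈ c.factCodes ++ c'.factCodes ↔
      ∃ ψ ∈ c.facts ++ c'.facts, Literal.code ψ = x := by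
    intro c c' x
    rw [← Certificate.map_code_facts, ← Certificate.map_code_facts, ← List.map_append,
      List.mem_map]
  have hmem : PrimrecRel fun (x : LitCode) (l : List LitCode) => x ∈ l :=
    (PrimrecRel.comp (Primrec.eq (α := LitCode)).exists_mem_list Primrec.snd
      Primrec.fst).of_eq fun p => by simp
  have hsub : PrimrecRel fun (l l' : List LitCode) => ∀ x ∈ l, x ∈ l' := hmem.forall_mem_list
  -- A finite set may be coded by any list, so lists of codes are compared by mutual inclusion.
  have hR : PrimrecRel fun (p : List LitCode × LitCode) (D : Bool × Certificate × Certificate) =>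
      (D.2.1.Valid ∧ D.2.2.Valid) ∧ ((∀ x ∈ p.1, x ∈ codes D) ∧ (∀ x ∈ codes D, x ∈ p.1)) ∧
        p.2 = (outLiteral D.1 D.2.1.1 D.2.2.1).code := by
    refine PrimrecPred.and (PrimrecPred.and ?_ ?_) (PrimrecPred.and (PrimrecPred.and ?_ ?_) ?_)
    · exact Certificate.primrecPred_valid.comp (Primrec.fst.comp (Primrec.snd.comp Primrec.snd))
    · exact Certificate.primrecPred_valid.comp (Primrec.snd.comp (Primrec.snd.comp Primrec.snd))
    · exact hsub.comp (Primrec.fst.comp Primrec.fst) (hcodes.comp Primrec.snd)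
    · exact hsub.comp (hcodes.comp Primrec.snd) (Primrec.fst.comp Primrec.fst)
    · exact Primrec.eq.comp (Primrec.snd.comp Primrec.fst)
        (primrec_code_outLiteral.comp ((Primrec.fst.comp Primrec.snd).pair
          ((Primrec.fst.comp (Primrec.fst.comp (Primrec.snd.comp Primrec.snd))).pair
            (Primrec.fst.comp (Primrec.snd.comp (Primrec.snd.comp Primrec.snd))))))
  refine (REPred.exists hR).of_eq fun p => ?_
  constructor
  · rintro ⟨⟨b, c, c'⟩, ⟨hc, hc'⟩, ⟨h1, h2⟩, h3⟩
    refine ⟨(c.facts ++ c'.facts).toFinset, outLiteral b c.1 c'.1,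
      ⟨b, c, c', hc, hc', fun ψ => List.mem_toFinset, rfl⟩, fun x => ?_, h3.symm⟩
    simp only [List.mem_toFinset]
    rw [← hmap]
    exact ⟨h1 x, h2 x⟩
  · rintro ⟨α, φ, ⟨b, c, c', hc, hc', hα, hφ⟩, h1, h2⟩
    have h1' : ∀ x, x ∈ p.1 ↔ x ∈ c.factCodes ++ c'.factCodes := fun x => by
      rw [h1, hmap]
      simp only [hα]
    refine ⟨(b, c, c'), ⟨hc, hc'⟩, ⟨fun x => (h1' x).1, fun x => (h1' x).2⟩, ?_⟩
    rw [← h2]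
    exact congrArg _ hφ

/-- Finite sets of positive relational facts are contained in the diagram of a finite
structure. -/
theorem exists_finite_diagram {L : FirstOrder.Language.{0, 0}} [FinRelLang L]
    (α : Finset (Literal L))
    (h : ∀ ψ ∈ α, ∃ (n : ℕ) (R : L.Relations n) (v : Fin n → ℕ), ψ = (true, .rel R v)) :
    ∃ A : NatStructure L, A.carrier.Finite ∧ ∀ ψ ∈ α, ψ ∈ diagram A := by
  let consts : Literal L → Set ℕ := fun ψ =>
    match ψ.2 with
    | .eq _ _ => ∅
    | .rel _ v => Set.range v
  have hrel : L.IsRelational := FinRelLang.relational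
  -- The universe consists of the constants mentioned, and every relation holds everywhere.
  refine ⟨⟨⋃ ψ ∈ α, consts ψ, ⟨fun {n} f => isEmptyElim (α := L.Functions n) f,
    fun _ _ => True⟩⟩, ?_, ?_⟩
  · refine Set.Finite.biUnion α.finite_toSet fun ψ hψ => ?_
    obtain ⟨n, R, v, rfl⟩ := h ψ hψ
    exact Set.finite_range v
  · intro ψ hψ
    obtain ⟨n, R, v, rfl⟩ := h ψ hψ
    have hv : ∀ i, v i ∈ ⋃ ψ ∈ α, consts ψ := fun i =>
      Set.mem_biUnion hψ (show v i ∈ consts (true, .rel R v) from Set.mem_range_self i)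
    exact ⟨hv, iff_of_true rfl ⟨hv, trivial⟩⟩

theorem exists_finite_of_mem_shuffleOperator
    (p : Finset (Literal vsLang) × Literal FirstOrder.Language.order)
    (hp : p ∈ shuffleOperator) :
    ∃ A : NatStructure vsLang, A.carrier.Finite ∧ ∀ ψ ∈ p.1, ψ ∈ diagram A := by
  obtain ⟨b, c, c', -, -, h, -⟩ := hp
  refine exists_finite_diagram p.1 fun ψ hψ => ?_
  rcases List.mem_append.1 ((h ψ).1 hψ) with h | h <;>
    exact Certificate.exists_rel_of_mem_facts h

theorem mem_enumApply_shuffleOperator {X : Set (Literal vsLang)}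
    {φ : Literal FirstOrder.Language.order} :
    φ ∈ enumApply shuffleOperator X ↔ ∃ (b : Bool) (c c' : Certificate),
      (c.Valid ∧ ∀ ψ ∈ c.facts, ψ ∈ X) ∧ (c'.Valid ∧ ∀ ψ ∈ c'.facts, ψ ∈ X) ∧
        φ = outLiteral b c.1 c'.1 := by
  classical
  constructor
  · rintro ⟨α, hα, b, c, c', hc, hc', h, hφ⟩
    exact ⟨b, c, c', ⟨hc, fun ψ hψ => hα ψ ((h ψ).2 (List.mem_append_left _ hψ))⟩,
      ⟨hc', fun ψ hψ => hα ψ ((h ψ).2 (List.mem_append_right _ hψ))⟩, hφ⟩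
  · rintro ⟨b, c, c', ⟨hc, h⟩, ⟨hc', h'⟩, hφ⟩
    refine ⟨(c.facts ++ c'.facts).toFinset, fun ψ hψ => ?_, b, c, c', hc, hc',
      fun ψ => List.mem_toFinset, hφ⟩
    rcases List.mem_append.1 (List.mem_toFinset.1 hψ) with hψ | hψ
    · exact h ψ hψ
    · exact h' ψ hψ

end Certificates

end CompEmb

/-- Induction on `n`, splitting off the last vector, which must avoid the span of its predecessors.
Coefficients indexed by `ℕ` fit sums that are computed one term at a time. -/
theorem linearIndependent_fin_iff_forall_ne {K V : Type*} [DivisionRing K] [AddCommGroup V]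
    [Module K V] (f : ℕ → V) (n : ℕ) : LinearIndependent K (fun i : Fin n => f i) ↔
      ∀ j < n, ∀ a : ℕ → K, f j ≠ ∑ i ∈ Finset.range j, a i • f i := by
  induction n with
  | zero => simp
  | succ n ih =>
    rw [linearIndependent_finSucc', Nat.forall_lt_succ_right]
    refine and_congr ih ?_
    rw [Submodule.mem_span_range_iff_exists_fun, not_exists]
    constructor
    · intro h a ha
      apply h fun i => a i
      rw [Fin.val_last, ha, Finset.sum_range]
      rfl
    · intro h a ha
      apply h fun i => if hi : i < n then a ⟨i, hi⟩ else 0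
      rw [Fin.val_last] at ha
      rw [← ha, Finset.sum_range]
      simp [Fin.init]

namespace CompEmb

open FirstOrder FirstOrder.Language

/-! ### Dimension classifies the vector space structures -/

section Isomorphisms

theorem IsVectorSpaceOfDim.of_isomorphic {d : ℕ} {A A' : NatStructure vsLang}
    (h : IsVectorSpaceOfDim d A) (hi : Isomorphic A A') : IsVectorSpaceOfDim d A' := by
  obtain ⟨W, i1, i2, hf, hd, ⟨e⟩⟩ := h
  obtain ⟨i⟩ := hi
  exact ⟨W, i1, i2, hf, hd, ⟨e.comp i.symm⟩⟩

/-- A linear equivalence induces an isomorphism of two-sorted structures. -/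
def vsEquiv {W W' : Type} [AddCommGroup W] [Module ℚ W] [AddCommGroup W'] [Module ℚ W']
    (l : W ≃ₗ[ℚ] W') : (ℚ ⊕ W) ≃[vsLang] (ℚ ⊕ W') where
  toEquiv := Equiv.sumCongr (Equiv.refl ℚ) l.toEquiv
  map_fun' := fun f => Empty.elim f
  map_rel' := by
    have hr : ∀ (z : ℚ ⊕ W) (w : W), Equiv.sumCongr (Equiv.refl ℚ) l.toEquiv z = .inr (l w) ↔
        z = .inr w := by
      rintro (q | w') w <;> simp
    have hl : ∀ (z : ℚ ⊕ W) (q : ℚ), Equiv.sumCongr (Equiv.refl ℚ) l.toEquiv z = .inl q ↔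
        z = .inl q := by
      rintro (q' | w') q <;> simp
    have h0 : ∀ (z : ℚ ⊕ W), Equiv.sumCongr (Equiv.refl ℚ) l.toEquiv z = .inr 0 ↔
        z = .inr 0 := fun z => by rw [← hr, map_zero]
    intro n R v
    cases R
    · exact l.surjective.exists.trans (exists_congr fun w => hr _ w)
    · exact exists_congr fun q => hl _ q
    · exact hl _ _
    · exact hl _ _
    · exact exists_congr fun p => exists_congr fun q =>
        and_congr (hl _ _) (and_congr (hl _ _) (hl _ _))
    · exact exists_congr fun p => exists_congr fun q =>
        and_congr (hl _ _) (and_congr (hl _ _) (hl _ _))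
    · exact h0 _
    · refine l.surjective.exists.trans (exists_congr fun x => l.surjective.exists.trans
        (exists_congr fun y => and_congr (hr _ _) (and_congr (hr _ _) ?_)))
      rw [← map_add]
      exact hr _ _
    · refine exists_congr fun q => l.surjective.exists.trans
        (exists_congr fun y => and_congr (hl _ _) (and_congr (hr _ _) ?_))
      rw [← map_smul]
      exact hr _ _

theorem IsVectorSpaceOfDim.isomorphic {d : ℕ} {A A' : NatStructure vsLang}
    (h : IsVectorSpaceOfDim d A) (h' : IsVectorSpaceOfDim d A') : Isomorphic A A' := by
  obtain ⟨W, _, _, hf, hd, ⟨e⟩⟩ := h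
  obtain ⟨W', _, _, hf', hd', ⟨e'⟩⟩ := h'
  exact ⟨(e'.symm.comp (vsEquiv (LinearEquiv.ofFinrankEq W W' (hd.trans hd'.symm)))).comp e⟩

end Isomorphisms

/-! ### Diagrams of suborders of `ω·η` -/

section OrderDiagram

/-- The suborder of `ω·η` whose elements are coded by the numbers in `S`. -/
noncomputable def orderOn (S : Set ℕ) : NatStructure FirstOrder.Language.order where
  carrier := S
  str := @orderStructure S (LE.mk fun x y => point x ≤ point y)

theorem orderOn_mem_LO (S : Set ℕ) : orderOn S ∈ LO := by
  let o : LinearOrder S := LinearOrder.lift' (fun x : S => point x)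
    (point_injective.comp Subtype.val_injective)
  have h : @OrderedStructure FirstOrder.Language.order S _ o.toLE (orderOn S).str :=
    @OrderedStructure.mk _ _ _ o.toLE (orderOn S).str fun _ => Iff.rfl
  exact @model_linearOrder FirstOrder.Language.order S _ (orderOn S).str o h

theorem mem_diagram_orderOn {S : Set ℕ} {φ : Literal FirstOrder.Language.order} :
    φ ∈ diagram (orderOn S) ↔ ∃ b, ∃ x ∈ S, ∃ y ∈ S, φ = outLiteral b x y := by
  classical
  constructor
  · rintro ⟨h1, h2⟩
    obtain ⟨t, φ⟩ := φ
    cases φ with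
    | eq m n =>
      refine ⟨true, m, h1.1, n, h1.2, Prod.ext ?_ rfl⟩
      exact Bool.eq_iff_iff.2 (h2.trans (decide_eq_true_iff (p := m = n)).symm)
    | rel R v =>
      cases R
      have hv : ![v 0, v 1] = v := by
        ext i
        fin_cases i <;> rfl
      refine ⟨false, v 0, h1 0, v 1, h1 1, Prod.ext ?_ ?_⟩
      · refine Bool.eq_iff_iff.2 (h2.trans (Iff.trans ?_ decide_eq_true_iff.symm))
        exact ⟨fun ⟨_, h⟩ => h, fun h => ⟨h1, h⟩⟩
      · exact congrArg (AtomicSentence.rel leSymb) hv.symm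
  · rintro ⟨b, x, hx, y, hy, rfl⟩
    cases b
    · have hv : ∀ i, ![x, y] i ∈ S := by
        intro i
        fin_cases i
        · exact hx
        · exact hy
      exact ⟨hv, decide_eq_true_iff.trans ⟨fun h => ⟨hv, h⟩, fun ⟨_, h⟩ => h⟩⟩
    · exact ⟨⟨hx, hy⟩, decide_eq_true_iff⟩

/-- The universe is read off from the literals `x = x`. -/
theorem carrier_eq_of_diagram_eq {L : FirstOrder.Language.{0, 0}} {B B' : NatStructure L}
    (h : diagram B = diagram B') : B.carrier = B'.carrier := by
  have key : ∀ (C : NatStructure L) (x : ℕ),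
      x ∈ C.carrier ↔ ((true, .eq x x) : Literal L) ∈ diagram C := fun C x =>
    ⟨fun hx => ⟨⟨hx, hx⟩, iff_of_true rfl rfl⟩, fun hx => hx.1.1⟩
  ext x
  rw [key, key, h]

theorem rel_mem_diagram {L : FirstOrder.Language.{0, 0}} {B : NatStructure L} {n : ℕ}
    {R : L.Relations n} {v : Fin n → ℕ} : ((true, .rel R v) : Literal L) ∈ diagram B ↔
      ∃ h : ∀ i, v i ∈ B.carrier, Structure.RelMap R fun i => (⟨v i, h i⟩ : B.carrier) :=
  ⟨fun h => h.2.1 rfl, fun h => ⟨h.1, iff_of_true rfl h⟩⟩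

theorem relMap_iff_of_diagram_eq_orderOn {B : NatStructure FirstOrder.Language.order} {S : Set ℕ}
    (h : diagram B = diagram (orderOn S)) (x y : B.carrier) :
    Structure.RelMap (leSymb : FirstOrder.Language.order.Relations 2) ![x, y] ↔
      point x ≤ point y := by
  have hS : B.carrier = S := carrier_eq_of_diagram_eq h
  have key := Set.ext_iff.1 h (true, .rel leSymb ![(x : ℕ), y])
  rw [rel_mem_diagram, rel_mem_diagram] at key
  have hB : ∀ i, ![(x : ℕ), y] i ∈ B.carrier := by
    intro i
    fin_cases i
    · exact x.2
    · exact y.2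
  have hv : (fun i => (⟨![(x : ℕ), y] i, hB i⟩ : B.carrier)) = ![x, y] := by
    ext i
    fin_cases i <;> rfl
  rw [← hv]
  constructor
  · intro hr
    exact (key.1 ⟨hB, hr⟩).2
  · intro hr
    exact (key.2 ⟨fun i => hS ▸ hB i, hr⟩).2

end OrderDiagram

/-! ### Block sizes computed in a vector space -/

section VectorDiagram

variable {A : NatStructure vsLang} {W : Type} [AddCommGroup W] [Module ℚ W]

/-- The name in `A` of a scalar or a vector. -/
def name (e : A.carrier ≃[vsLang] (ℚ ⊕ W)) (z : ℚ ⊕ W) : ℕ := e.symm z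

/-- The name in `A` of a vector. -/
def vname (e : A.carrier ≃[vsLang] (ℚ ⊕ W)) (w : W) : ℕ := name e (.inr w)

variable (e : A.carrier ≃[vsLang] (ℚ ⊕ W))

theorem name_injective : Function.Injective (name e) :=
  Subtype.val_injective.comp e.symm.injective

theorem vname_injective : Function.Injective (vname e) :=
  (name_injective e).comp Sum.inr_injective

theorem rel_mem_diagram_iff_name {n : ℕ} {R : vsLang.Relations n} {v : Fin n → ℕ} :
    ((true, .rel R v) : Literal vsLang) ∈ diagram A ↔
      ∃ z : Fin n → ℚ ⊕ W, (∀ i, v i = name e (z i)) ∧ Structure.RelMap R z := by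
  rw [rel_mem_diagram]
  constructor
  · rintro ⟨h, hr⟩
    refine ⟨fun i => e ⟨v i, h i⟩, fun i => ?_, (e.map_rel R _).2 hr⟩
    simp [name]
  · rintro ⟨z, hz, hr⟩
    have hz' : v = fun i => name e (z i) := funext hz
    subst hz'
    exact ⟨fun i => (e.symm (z i)).2, (e.symm.map_rel R z).2 hr⟩

theorem isVector_mem_diagram {x : ℕ} :
    ((true, .rel VSRel.isVector ![x]) : Literal vsLang) ∈ diagram A ↔ ∃ w, x = vname e w := by
  refine (rel_mem_diagram_iff_name e).trans ?_
  constructor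
  · rintro ⟨z, hz, w, hw⟩
    exact ⟨w, (hz 0).trans (congrArg _ hw)⟩
  · rintro ⟨w, rfl⟩
    exact ⟨fun _ => .inr w, by simp [vname], w, rfl⟩

theorem zeroV_mem_diagram {x : ℕ} :
    ((true, .rel VSRel.zeroV ![x]) : Literal vsLang) ∈ diagram A ↔ x = vname e 0 := by
  refine (rel_mem_diagram_iff_name e).trans ?_
  constructor
  · rintro ⟨z, hz, hw⟩
    exact (hz 0).trans (congrArg _ hw)
  · rintro rfl
    exact ⟨fun _ => .inr 0, by simp [vname], rfl⟩

theorem smulV_mem_diagram {s x y : ℕ} :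
    ((true, .rel VSRel.smulV ![s, x, y]) : Literal vsLang) ∈ diagram A ↔
      ∃ (q : ℚ) (w : W), s = name e (.inl q) ∧ x = vname e w ∧ y = vname e (q • w) := by
  refine (rel_mem_diagram_iff_name e).trans ?_
  constructor
  · rintro ⟨z, hz, q, w, h0, h1, h2⟩
    exact ⟨q, w, (hz 0).trans (congrArg _ h0), (hz 1).trans (congrArg _ h1),
      (hz 2).trans (congrArg _ h2)⟩
  · rintro ⟨q, w, rfl, rfl, rfl⟩
    refine ⟨![.inl q, .inr w, .inr (q • w)], fun i => ?_, q, w, rfl, rfl, rfl⟩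
    fin_cases i <;> rfl

theorem addV_mem_diagram {x y z : ℕ} :
    ((true, .rel VSRel.addV ![x, y, z]) : Literal vsLang) ∈ diagram A ↔
      ∃ v w : W, x = vname e v ∧ y = vname e w ∧ z = vname e (v + w) := by
  refine (rel_mem_diagram_iff_name e).trans ?_
  constructor
  · rintro ⟨z, hz, v, w, h0, h1, h2⟩
    exact ⟨v, w, (hz 0).trans (congrArg _ h0), (hz 1).trans (congrArg _ h1),
      (hz 2).trans (congrArg _ h2)⟩
  · rintro ⟨v, w, rfl, rfl, rfl⟩
    refine ⟨![.inr v, .inr w, .inr (v + w)], fun i => ?_, v, w, rfl, rfl, rfl⟩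
    fin_cases i <;> rfl

/-- Some entry of the list is a linear combination of the earlier ones. -/
def Dependent (T : List W) : Prop :=
  ∃ j < T.length, ∃ a : ℕ → ℚ, T.getD j 0 = ∑ i ∈ Finset.range j, a i • T.getD i 0

theorem not_dependent_iff (T : List W) :
    ¬ Dependent T ↔ LinearIndependent ℚ (fun i : Fin T.length => T.getD i 0) := by
  rw [linearIndependent_fin_iff_forall_ne (fun i => T.getD i 0)]
  simp [Dependent]

open Classical in
/-- The size of the blocks with attached tuple `t`. -/
noncomputable def blockSize (t : List ℕ) : ℕ∞ :=
  if ∃ T : List W, t = T.map (vname e) then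
    if ∃ T : List W, t = T.map (vname e) ∧ Dependent T then ⊤ else t.length
  else 0

theorem blockSize_of_dependent {T : List W} (h : Dependent T) :
    blockSize e (T.map (vname e)) = ⊤ := by
  rw [blockSize, if_pos ⟨T, rfl⟩, if_pos ⟨T, rfl, h⟩]

theorem blockSize_of_not_dependent {T : List W} (h : ¬ Dependent T) :
    blockSize e (T.map (vname e)) = T.length := by
  rw [blockSize, if_pos ⟨T, rfl⟩, if_neg, List.length_map]
  rintro ⟨T', hT', h'⟩
  exact h ((vname_injective e).list_map hT' ▸ h')

theorem exists_eq_map_of_blockSize_ne_zero {t : List ℕ} (h : blockSize e t ≠ 0) :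
    ∃ T : List W, t = T.map (vname e) := by
  by_contra hT
  exact h (if_neg hT)

theorem getD_map_vname {T : List W} {i : ℕ} (hi : i < T.length) :
    (T.map (vname e)).getD i 0 = vname e (T.getD i 0) := by
  simp [List.getD_eq_getElem?_getD, hi]

/-- Soundness of certificates: by induction, each partial sum names a linear combination of the
earlier entries, and the last one is an entry of the tuple. -/
theorem dependent_of_facts {c : Certificate} {T : List W} (hT : tuple c.1 = T.map (vname e))
    (hoff : ¬ offset c.1 < (tuple c.1).length) (hc : c.Valid)
    (h : ∀ ψ ∈ c.facts, ψ ∈ diagram A) : Dependent T := by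
  obtain ⟨hj, hlast⟩ := hc.resolve_left hoff
  have hmem : ∀ ψ, ψ ∈ ((true, .rel VSRel.zeroV ![c.partialSum 0]) ::
      (List.range c.2.1).flatMap fun i =>
        [(true, .rel VSRel.smulV ![c.coeff i, c.entry i, c.term i]),
          (true, .rel VSRel.addV ![c.partialSum i, c.term i, c.partialSum (i + 1)])] :
            List (Literal vsLang)) → ψ ∈ diagram A := by
    intro ψ hψ
    apply h
    rw [Certificate.facts, if_neg hoff]
    exact List.mem_append_right _ hψ
  simp only [List.mem_cons, List.mem_flatMap, List.mem_range, List.not_mem_nil, or_false] at hmem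
  rw [hT, List.length_map] at hj
  have hentry : ∀ i < T.length, c.entry i = vname e (T.getD i 0) := fun i hi => by
    rw [Certificate.entry, hT, getD_map_vname e hi]
  have key : ∀ i ≤ c.2.1, ∃ a : ℕ → ℚ,
      c.partialSum i = vname e (∑ l ∈ Finset.range i, a l • T.getD l 0) := by
    intro i
    induction i with
    | zero =>
      intro _
      exact ⟨0, by simpa using (zeroV_mem_diagram e).1 (hmem _ (Or.inl rfl))⟩
    | succ i ih =>
      intro hi
      obtain ⟨a, ha⟩ := ih (Nat.le_of_succ_le hi)
      obtain ⟨q, w, -, h1, h2⟩ := (smulV_mem_diagram e).1 (hmem _ (Or.inr ⟨i, hi, Or.inl rfl⟩))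
      obtain ⟨v, w', h3, h4, h5⟩ := (addV_mem_diagram e).1 (hmem _ (Or.inr ⟨i, hi, Or.inr rfl⟩))
      have hw : T.getD i 0 = w := vname_injective e ((hentry i (by omega)).symm.trans h1)
      have hv : _ = v := vname_injective e (ha.symm.trans h3)
      have hw' : _ = w' := vname_injective e (h2.symm.trans h4)
      -- The new coefficient is the scalar named in the multiplication fact; the earlier ones do not
      -- change.
      refine ⟨Function.update a i q, h5.trans (congrArg _ ?_)⟩
      rw [Finset.sum_range_succ, Function.update_self, ← hv, ← hw', ← hw]
      congr 1
      refine Finset.sum_congr rfl fun l hl => ?_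
      rw [Function.update_of_ne (Finset.mem_range.1 hl).ne]
  obtain ⟨a, ha⟩ := key _ le_rfl
  exact ⟨c.2.1, hj, a, vname_injective e ((hentry _ hj).symm.trans (hlast.symm.trans ha))⟩

/-- Completeness of certificates: the names of the coefficients, multiples and partial sums of a
given dependence are written down. -/
theorem exists_certificate_of_dependent {x : ℕ} {T : List W} (hT : tuple x = T.map (vname e))
    (hdep : Dependent T) :
    ∃ c : Certificate, c.1 = x ∧ c.Valid ∧ ∀ ψ ∈ c.facts, ψ ∈ diagram A := by
  obtain ⟨j, hj, a, ha⟩ := hdep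
  let U : ℕ → W := fun i => ∑ l ∈ Finset.range i, a l • T.getD l 0
  -- There are `j + 1` triples, since the sum of the `j` terms before the `j`-th entry is stored at
  -- index `j`.
  let L : List (ℕ × ℕ × ℕ) := (List.range (j + 1)).map fun i =>
    (name e (.inl (a i)), vname e (a i • T.getD i 0), vname e (U i))
  let c : Certificate := (x, j, L)
  have hL : ∀ i ≤ j, L.getD i (0, 0, 0) =
      (name e (.inl (a i)), vname e (a i • T.getD i 0), vname e (U i)) := by
    intro i hi
    simp [L, List.getD_eq_getElem?_getD, Nat.lt_succ_of_le hi]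
  have hcoeff : ∀ i ≤ j, c.coeff i = name e (.inl (a i)) := fun i hi =>
    congrArg (fun z => z.1) (hL i hi)
  have hterm : ∀ i ≤ j, c.term i = vname e (a i • T.getD i 0) := fun i hi =>
    congrArg (fun z => z.2.1) (hL i hi)
  have hsum : ∀ i ≤ j, c.partialSum i = vname e (U i) := fun i hi =>
    congrArg (fun z => z.2.2) (hL i hi)
  have hentry : ∀ i < T.length, c.entry i = vname e (T.getD i 0) := fun i hi => by
    rw [Certificate.entry, hT, getD_map_vname e hi]
  refine ⟨c, rfl, Or.inr ⟨?_, ?_⟩, ?_⟩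
  · rw [hT, List.length_map]
    exact hj
  · rw [hsum j le_rfl, hentry j hj, ha]
  · intro ψ hψ
    rw [Certificate.facts, List.mem_append] at hψ
    rcases hψ with hψ | hψ
    · obtain ⟨y, hy, rfl⟩ := List.mem_map.1 hψ
      rw [hT] at hy
      obtain ⟨w, -, rfl⟩ := List.mem_map.1 hy
      exact (isVector_mem_diagram e).2 ⟨w, rfl⟩
    · split_ifs at hψ
      · simp at hψ
      · simp only [List.mem_cons, List.mem_flatMap, List.mem_range, List.not_mem_nil,
          or_false] at hψ
        rcases hψ with rfl | ⟨i, hi, rfl | rfl⟩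
        · rw [zeroV_mem_diagram e, hsum 0 (Nat.zero_le _)]
          simp [U]
        · rw [smulV_mem_diagram e, hcoeff i hi.le, hentry i (hi.trans hj), hterm i hi.le]
          exact ⟨_, _, rfl, rfl, rfl⟩
        · rw [addV_mem_diagram e, hsum i hi.le, hterm i hi.le, hsum (i + 1) hi]
          exact ⟨_, _, rfl, rfl, congrArg _ (Finset.sum_range_succ _ _)⟩

/-- The elements with a certificate that is correct in `A` are those which lie in their block. -/
theorem exists_certificate_iff {x : ℕ} :
    (∃ c : Certificate, c.1 = x ∧ c.Valid ∧ ∀ ψ ∈ c.facts, ψ ∈ diagram A) ↔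
      (offset x : ℕ∞) < blockSize e (tuple x) := by
  constructor
  · rintro ⟨c, rfl, hc, h⟩
    have hvec : ∀ y ∈ tuple c.1, y ∈ Set.range (vname e) := fun y hy => by
      obtain ⟨w, hw⟩ := (isVector_mem_diagram e).1 (h _ (by
        rw [Certificate.facts]
        exact List.mem_append_left _ (List.mem_map_of_mem hy)))
      exact ⟨w, hw.symm⟩
    obtain ⟨T, hT⟩ : ∃ T : List W, T.map (vname e) = tuple c.1 := by
      rw [← Set.mem_range, Set.range_list_map]
      exact hvec
    by_cases hoff : offset c.1 < (tuple c.1).length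
    · by_cases hdep : Dependent T
      · rw [← hT, blockSize_of_dependent e hdep]
        exact ENat.natCast_lt_top _
      · rw [← hT, blockSize_of_not_dependent e hdep]
        rw [← hT, List.length_map] at hoff
        exact_mod_cast hoff
    · rw [← hT, blockSize_of_dependent e (dependent_of_facts e hT.symm hoff hc h)]
      exact ENat.natCast_lt_top _
  · intro h
    obtain ⟨T, hT⟩ := exists_eq_map_of_blockSize_ne_zero e (pos_of_gt h).ne'
    by_cases hdep : Dependent T
    · exact exists_certificate_of_dependent e hT hdep
    · rw [hT, blockSize_of_not_dependent e hdep] at h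
      have hoff : offset x < (tuple x).length := by
        rw [hT, List.length_map]
        exact_mod_cast h
      -- Below the length of the tuple no computation is required, so the certificate may be empty.
      refine ⟨(x, 0, []), rfl, Or.inl hoff, fun ψ hψ => ?_⟩
      rw [Certificate.facts, if_pos hoff, List.append_nil] at hψ
      obtain ⟨y, hy, rfl⟩ := List.mem_map.1 hψ
      simp only [hT] at hy
      obtain ⟨w, -, rfl⟩ := List.mem_map.1 hy
      exact (isVector_mem_diagram e).2 ⟨w, rfl⟩

theorem enumApply_shuffleOperator : enumApply shuffleOperator (diagram A) =
    diagram (orderOn {x | (offset x : ℕ∞) < blockSize e (tuple x)}) := by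
  ext φ
  rw [mem_enumApply_shuffleOperator, mem_diagram_orderOn]
  constructor
  · rintro ⟨b, c, c', hc, hc', rfl⟩
    exact ⟨b, c.1, (exists_certificate_iff e).1 ⟨c, rfl, hc⟩, c'.1,
      (exists_certificate_iff e).1 ⟨c', rfl, hc'⟩, rfl⟩
  · rintro ⟨b, x, hx, y, hy, rfl⟩
    obtain ⟨c, rfl, hc⟩ := (exists_certificate_iff e).2 hx
    obtain ⟨c', rfl, hc'⟩ := (exists_certificate_iff e).2 hy
    exact ⟨b, c, c', hc, hc', rfl⟩

open Classical in
/-- The size of the block at a given position. -/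
noncomputable def sizeAt (q : ℚ) : ℕ∞ :=
  if h : ∃ p : ℕ × ℕ, q = position p.1 p.2 then blockSize e (levelTuple h.choose.2) else 0

/-- The choice in `sizeAt` is immaterial, because a position determines its level. -/
theorem sizeAt_position (a n : ℕ) : sizeAt e (position a n) = blockSize e (levelTuple n) := by
  have h : ∃ p : ℕ × ℕ, position a n = position p.1 p.2 := ⟨(a, n), rfl⟩
  rw [sizeAt, dif_pos h, ← (position_inj h.choose_spec).2]

theorem dense_sizeAt (t : List ℕ) : Dense {q | sizeAt e q = blockSize e t} := by
  refine (dense_position t).mono ?_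
  rintro _ ⟨a, n, rfl, rfl⟩
  exact sizeAt_position e a n

theorem isShuffleMap_sizeAt [FiniteDimensional ℚ W] :
    IsShuffleMap (Module.finrank ℚ W) (sizeAt e) := by
  refine ⟨fun q => ?_, fun n _ hn => ?_, ?_⟩
  · rw [sizeAt]
    split_ifs with h
    · generalize levelTuple h.choose.2 = t
      by_cases h0 : blockSize e t = 0
      · exact Or.inl (by simp [h0])
      obtain ⟨T, rfl⟩ := exists_eq_map_of_blockSize_ne_zero e h0
      by_cases hdep : Dependent T
      · exact Or.inr (blockSize_of_dependent e hdep)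
      · left
        rw [blockSize_of_not_dependent e hdep]
        have := ((not_dependent_iff T).1 hdep).fintype_card_le_finrank
        rw [Fintype.card_fin] at this
        exact_mod_cast this
    · exact Or.inl zero_le
  -- The first `n` vectors of a basis form an independent tuple of length `n`.
  · let b := Module.finBasis ℚ W
    let f : Fin n → W := fun i => b (Fin.castLE hn i)
    have hf : LinearIndependent ℚ f :=
      b.linearIndependent.comp _ (Fin.castLE_injective hn)
    have hlen : (List.ofFn f).length = n := List.length_ofFn
    have hT : ¬ Dependent (List.ofFn f) := by
      rw [not_dependent_iff]
      convert! hf.comp (Fin.cast hlen) (Fin.cast_injective hlen) using 2 with i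
      have hi : (i : ℕ) < n := i.2.trans_eq hlen
      simp [List.getD_eq_getElem?_getD, hi]
      rfl
    have := dense_sizeAt e ((List.ofFn f).map (vname e))
    rwa [blockSize_of_not_dependent e hT, hlen] at this
  -- The zero vector is the empty sum, so this tuple is dependent in every dimension, including `0`.
  · have := dense_sizeAt e ([(0 : W)].map (vname e))
    rwa [blockSize_of_dependent e ⟨0, by simp, 0, by simp⟩] at this

/-- The constructed order is a suborder of `ω·η` of the prescribed form. -/
theorem exists_equiv_cut {S : Set ℕ} (hS : S = {x | (offset x : ℕ∞) < blockSize e (tuple x)}) :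
    ∃ i : S ≃ Cut (sizeAt e), ∀ x, (i x).1 = point x := by
  subst hS
  have hmem : ∀ x : ℕ, ((ofLex (point x)).2 : ℕ∞) < sizeAt e (ofLex (point x)).1 ↔
      (offset x : ℕ∞) < blockSize e (tuple x) := fun x => by
    rw [point, ofLex_toLex, sizeAt_position]
    rfl
  refine ⟨Equiv.ofBijective (fun x => ⟨point x, (hmem x).2 x.2⟩) ⟨fun x y hxy => ?_, ?_⟩,
    fun x => rfl⟩
  · exact Subtype.ext (point_injective (congrArg Subtype.val hxy))
  · rintro ⟨z, hz⟩
    obtain ⟨a, n, hq⟩ : ∃ a n, (ofLex z).1 = position a n := by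
      by_contra hne
      rw [sizeAt, dif_neg fun ⟨p, hp⟩ => hne ⟨p.1, p.2, hp⟩] at hz
      simp at hz
    obtain ⟨x, rfl, rfl, hk⟩ := exists_point_eq a n (ofLex z).2
    have hx : point x = z := by
      rw [point, hk, ← hq]
      rfl
    subst hx
    exact ⟨⟨x, (hmem x).1 hz⟩, rfl⟩

end VectorDiagram

/-! ### The embedding -/

theorem IsVectorSpaceOfDim.isShuffle {d : ℕ} {A : NatStructure vsLang}
    (hA : IsVectorSpaceOfDim d A) {B : NatStructure FirstOrder.Language.order}
    (h : enumApply shuffleOperator (diagram A) = diagram B) : IsShuffle d B := by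
  obtain ⟨W, _, _, _, rfl, ⟨e⟩⟩ := hA
  rw [enumApply_shuffleOperator e] at h
  obtain ⟨i, hi⟩ := exists_equiv_cut e (carrier_eq_of_diagram_eq h).symm
  have hm := isShuffleMap_sizeAt e
  refine ⟨sizeAt e, hm.le_or_top, hm.dense_nat, hm.dense_top, i, fun x y => ?_⟩
  rw [relMap_iff_of_diagram_eq_orderOn h.symm, hi, hi]

end CompEmb

theorem proposition4p12 :
    ∃ Φ : Set (Finset (CompEmb.Literal CompEmb.vsLang) ×
        CompEmb.Literal FirstOrder.Language.order),
      CompEmb.IsComputableEmbedding Φ CompEmb.FVS CompEmb.LO ∧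
      ∀ (d : ℕ) (A : CompEmb.NatStructure CompEmb.vsLang), CompEmb.IsVectorSpaceOfDim d A →
        ∀ B : CompEmb.NatStructure FirstOrder.Language.order,
          CompEmb.enumApply Φ (CompEmb.diagram A) = CompEmb.diagram B →
            CompEmb.IsShuffle d B := by
  refine ⟨CompEmb.shuffleOperator, ⟨⟨CompEmb.isCE_shuffleOperator,
    CompEmb.exists_finite_of_mem_shuffleOperator, ?_⟩, ?_⟩, fun d A hA B h => hA.isShuffle h⟩
  · rintro A ⟨d, W, _, _, _, -, ⟨e⟩⟩
    exact ⟨_, CompEmb.orderOn_mem_LO _, CompEmb.enumApply_shuffleOperator e⟩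
  · rintro A ⟨d, hA⟩ A' ⟨d', hA'⟩ B B' h h'
    constructor
    · intro hi
      exact (hA.isShuffle h).isomorphic ((hA.of_isomorphic hi).isShuffle h')
    · intro hi
      obtain rfl := (hA.isShuffle h).eq_of_isomorphic (hA'.isShuffle h') hi
      exact hA.isomorphic hA'
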